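/- Let $G$ be a torsion-free hyperbolic group: every non-identity element of $G$ has infinite order, and $G$ has a finite generating set $S$ such that the Cayley graph of $G$ with respect to $S$, with the word metric, is Gromov hyperbolic, i.e. there is $\delta\ge 0$ such that in every geodesic triangle each side is contained in the $\delta$-neighbourhood of the union of the other two sides. Then the diagonal subgroup $\operatorname{diag}(G)=\{(x,x):x\in G\}$ has the subconjugacy property in $G\times G$: writing $H=\operatorname{diag}(G)$ and $H^{a}=a^{-1}Ha$, for every sequence $(a_n)_{n\in\mathbb N}$ in $G\times G$ there exists $a\in G\times G$ such that \[ \bigcup_{k}\ \bigcap_{n\ge k} H^{a_n}\ \subseteq\ H^{a}. \] -/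

import Mathlib

/-- A walk in a graph is geodesic if its length realizes the graph distance of its endpoints. -/
def WalkIsGeodesic {V : Type*} {Γ : SimpleGraph V} {x y : V} (p : Γ.Walk x y) : Prop :=
  p.length = Γ.dist x y

/-- A graph is Gromov hyperbolic if, for some `δ`, all its geodesic triangles are `δ`-slim: each
side lies in the `δ`-neighbourhood of the union of the other two. (All triangles are quantified
over, so it is enough to say this for the first side.) -/
def GraphIsGromovHyperbolic {V : Type*} (Γ : SimpleGraph V) : Prop :=
  ∃ δ : ℕ, ∀ (x y z : V) (p : Γ.Walk x y) (q : Γ.Walk y z) (r : Γ.Walk z x),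
    WalkIsGeodesic p → WalkIsGeodesic q → WalkIsGeodesic r →
      ∀ v ∈ p.support, ∃ w : V, (w ∈ q.support ∨ w ∈ r.support) ∧ Γ.dist v w ≤ δ

/-- A finitely generated group is hyperbolic if its Cayley graph with respect to some finite
generating set is Gromov hyperbolic. Since the set generates, the Cayley graph is connected and
its graph distance is the word metric. -/
def GroupIsHyperbolic (G : Type*) [Group G] : Prop :=
  ∃ S : Finset G, Subgroup.closure (S : Set G) = ⊤ ∧
    GraphIsGromovHyperbolic (SimpleGraph.mulCayley (S : Set G))

/-- A group is torsion free if every element other than the identity has infinite order. -/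
def GroupIsTorsionFree (G : Type*) [Group G] : Prop :=
  ∀ g : G, g ≠ 1 → ¬ IsOfFinOrder g

/-- The conjugate `H ^ g = g⁻¹ H g`. -/
def conjSubgroup {G : Type*} [Group G] (H : Subgroup G) (g : G) : Subgroup G :=
  H.map (MulAut.conj g⁻¹).toMonoidHom

/-- `H` has the subconjugacy property in `G`: for every sequence `gₙ` in `G` there is `g` in `G`
with `⋃ₖ ⋂_{n ≥ k} gₙ⁻¹ H gₙ ⊆ g⁻¹ H g`. -/
def HasSubconjugacyProperty {G : Type*} [Group G] (H : Subgroup G) : Prop :=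
  ∀ g : ℕ → G, ∃ a : G,
    (⋃ k : ℕ, ⋂ n : ℕ, ⋂ _ : k ≤ n, (conjSubgroup H (g n) : Set G)) ⊆ (conjSubgroup H a : Set G)

/-- The diagonal subgroup `{(x, x) : x ∈ G}` of `G × G`. -/
def diagSubgroup (G : Type*) [Group G] : Subgroup (G × G) :=
  ((MonoidHom.id G).prod (MonoidHom.id G)).range

open SimpleGraph

/-! A conjugate of the diagonal is the graph of an inner automorphism, so the claim is that a
sequence of conjugations by `c n` agrees with a single conjugation wherever it is eventually
constant. This holds once commuting is transitive on nontrivial elements: either some stabilized set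
has trivial centralizer, and `c n` is eventually constant, or all stabilized elements commute, and
an early `c k₀` serves for all.

Transitivity comes from centralizers being abelian. For `g ≠ 1`, slimness and pigeonhole show that
`⟨g⟩` has finite index in its centralizer. The center of the centralizer then has finite index, and
the transfer and torsion-freeness make the centralizer abelian. -/

theorem SimpleGraph.Walk.dist_getVert_le {V : Type*} {Γ : SimpleGraph V} {x y : V}
    (p : Γ.Walk x y) (i j : ℕ) (hij : i ≤ j) : Γ.dist (p.getVert i) (p.getVert j) ≤ j - i := by
  calc Γ.dist (p.getVert i) (p.getVert j)
      = Γ.dist ((p.drop i).getVert 0) ((p.drop i).getVert (j - i)) := by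
        simp [Walk.drop_getVert, Nat.add_sub_cancel' hij]
    _ ≤ (((p.drop i).take (j - i))).length := by
        rw [Walk.getVert_zero]; exact dist_le _
    _ ≤ j - i := by rw [Walk.take_length]; exact min_le_left _ _

open scoped Pointwise

/-! ### Word metric and slim quadrilaterals -/

namespace CayleyGraph

variable {G : Type*} [Group G] {S : Set G}

/-- Left translation as an endomorphism of the Cayley graph. -/
def translation (S : Set G) (g : G) : mulCayley S →g mulCayley S where
  toFun := (g * ·)
  map_rel' h := mulCayley_adj_mul_iff_right.mpr h

theorem reachable_mul {x y : G} (g : G) (h : (mulCayley S).Reachable x y) :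
    (mulCayley S).Reachable (g * x) (g * y) :=
  h.map (translation S g)

theorem connected (hS : Subgroup.closure S = ⊤) : (mulCayley S).Connected := by
  have key : ∀ x : G, (mulCayley S).Reachable 1 x := by
    intro x
    have hx : x ∈ Subgroup.closure S := hS ▸ Subgroup.mem_top x
    induction hx using Subgroup.closure_induction with
    | mem x hx =>
      by_cases h : (1 : G) = x
      · exact h ▸ Reachable.refl _
      · exact Adj.reachable ((mulCayley_adj S 1 x).mpr ⟨h, Or.inl (by simpa using hx)⟩)
    | one => exact Reachable.refl _
    | mul x y _ _ hx hy => exact hx.trans (by simpa using reachable_mul x hy)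
    | inv x _ hx => exact (by simpa using reachable_mul x⁻¹ hx.symm)
  exact { preconnected := fun x y => (key x).symm.trans (key y), nonempty := ⟨1⟩ }

theorem dist_mul_le (hS : Subgroup.closure S = ⊤) (g x y : G) :
    (mulCayley S).dist (g * x) (g * y) ≤ (mulCayley S).dist x y := by
  obtain ⟨p, hp⟩ := (connected hS).exists_walk_length_eq_dist x y
  rw [← hp, ← Walk.length_map (translation S g) p]
  exact dist_le _

theorem dist_mul (hS : Subgroup.closure S = ⊤) (g x y : G) :
    (mulCayley S).dist (g * x) (g * y) = (mulCayley S).dist x y :=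
  (dist_mul_le hS g x y).antisymm (by simpa using dist_mul_le hS g⁻¹ (g * x) (g * y))

theorem exists_translate_walk (hS : Subgroup.closure S = ⊤) {g x y x' y' : G}
    (hx : g * x = x') (hy : g * y = y') (p : (mulCayley S).Walk x y) (hp : WalkIsGeodesic p) :
    ∃ q : (mulCayley S).Walk x' y', WalkIsGeodesic q ∧
      ∀ u ∈ q.support, ∃ v ∈ p.support, g * v = u := by
  subst hx hy
  refine ⟨p.map (translation S g), ?_,
    fun u (hu : u ∈ (p.map (translation S g)).support) => ?_⟩
  · exact (Walk.length_map _ _).trans (hp.trans (dist_mul hS g x y).symm)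
  · rw [Walk.support_map] at hu
    exact List.mem_map.mp hu

theorem finite_pow (hS : S.Finite) (n : ℕ) : (S ^ n).Finite := by
  induction n with
  | zero => simp
  | succ n ih => exact pow_succ S n ▸ ih.mul hS

theorem finite_ball (hfin : S.Finite) (hS : Subgroup.closure S = ⊤) (r : ℕ) :
    {x : G | (mulCayley S).dist 1 x ≤ r}.Finite := by
  have key : ∀ (n : ℕ) (x y : G) (p : (mulCayley S).Walk x y), p.length = n →
      x⁻¹ * y ∈ (insert 1 (S ∪ S⁻¹)) ^ n := by
    intro n
    induction n with
    | zero =>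
      intro x y p hp
      obtain rfl := Walk.eq_of_length_eq_zero hp
      simp
    | succ n ih =>
      intro x y p hp
      cases p with
      | nil => simp at hp
      | @cons _ z _ h q =>
        rw [pow_succ']
        refine Set.mem_mul.mpr ⟨x⁻¹ * z, ?_, z⁻¹ * y, ih z y q (by simpa using hp), by group⟩
        rcases ((mulCayley_adj S x z).mp h).2 with h | h
        · exact Or.inr (Or.inl h)
        · exact Or.inr (Or.inr (by simpa using h))
  -- Including `1` makes the powers increasing, so the `r`-th one contains all shorter words.
  refine (finite_pow ((hfin.union hfin.inv).insert 1) r).subset fun x hx => ?_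
  obtain ⟨p, hp⟩ := (connected hS).exists_walk_length_eq_dist 1 x
  have := key _ 1 x p rfl
  rw [inv_one, one_mul] at this
  exact Set.pow_subset_pow_right (Set.mem_insert _ _) (hp.trans_le hx) this

/-- If `h` commutes with `z`, and `z` cannot be shortened by multiplying with `h` or `h⁻¹`, then
`h` displaces points far from the ends of a geodesic from `1` to `z` by at most `4 * δ`. -/
theorem dist_mul_getVert_le (hS : Subgroup.closure S = ⊤) {δ : ℕ}
    (hδ : ∀ (x y z : G) (p : (mulCayley S).Walk x y) (q : (mulCayley S).Walk y z)
      (r : (mulCayley S).Walk z x), WalkIsGeodesic p → WalkIsGeodesic q → WalkIsGeodesic r →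
      ∀ v ∈ p.support, ∃ w : G, (w ∈ q.support ∨ w ∈ r.support) ∧ (mulCayley S).dist v w ≤ δ)
    {h z : G} (hz : Commute h z) (σ : (mulCayley S).Walk 1 z) (hσ : WalkIsGeodesic σ)
    (h₁ : (mulCayley S).dist 1 z ≤ (mulCayley S).dist 1 (h * z))
    (h₂ : (mulCayley S).dist 1 z ≤ (mulCayley S).dist 1 (h⁻¹ * z)) {k : ℕ}
    (hk : (mulCayley S).dist 1 h + 2 * δ < k)
    (hk' : k + (mulCayley S).dist 1 h + 2 * δ < (mulCayley S).dist 1 z) :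
    (mulCayley S).dist (σ.getVert k) (h * σ.getVert k) ≤ 4 * δ := by
  set d := (mulCayley S).dist
  have tri : ∀ a b c : G, d a c ≤ d a b + d b c := fun a b c => (connected hS).dist_triangle
  have symm : ∀ a b : G, d a b = d b a := fun a b => dist_comm
  have hmul : ∀ a b c : G, d (a * b) (a * c) = d b c := dist_mul hS
  have hL : σ.length = d 1 z := hσ
  have hγ : ∀ i j, i ≤ j → d (σ.getVert i) (σ.getVert j) ≤ j - i := σ.dist_getVert_le
  have hγ0 : ∀ i, d 1 (σ.getVert i) ≤ i := fun i => by simpa using hγ 0 i (Nat.zero_le i)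
  have hγL : ∀ i ≤ d 1 z, d (σ.getVert i) z ≤ d 1 z - i := fun i hi => by
    have := hγ i σ.length (by lia)
    rwa [σ.getVert_length, hL] at this
  have hend : d z (h * z) = d 1 h := by
    rw [hz.eq]; simpa using hmul z 1 h
  -- points on a geodesic are no farther from its ends than the ends from each other
  have hsub : ∀ (x y u : G) (p : (mulCayley S).Walk x y), WalkIsGeodesic p → u ∈ p.support →
      d x u ≤ d x y := by
    intro x y u p hp hu
    obtain ⟨i, rfl, hi⟩ := Walk.mem_support_iff_exists_getVert.mp hu
    have h1 := p.dist_getVert_le 0 i (Nat.zero_le i)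
    have h2 : p.length = d x y := hp
    simp only [Walk.getVert_zero] at h1
    change d x _ ≤ _ at h1
    lia
  obtain ⟨e, he⟩ := (connected hS).exists_walk_length_eq_dist z (h * z)
  obtain ⟨f, hf⟩ := (connected hS).exists_walk_length_eq_dist (h * z) 1
  obtain ⟨b, hb⟩ := (connected hS).exists_walk_length_eq_dist 1 h
  obtain ⟨τ, hτg, hτ⟩ : ∃ τ : (mulCayley S).Walk h (h * z), WalkIsGeodesic τ ∧
      ∀ u ∈ τ.support, ∃ v ∈ σ.support, h * v = u :=
    exists_translate_walk hS (mul_one h) rfl σ hσ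
  set p := σ.getVert k
  have hp0 := hγ0 k
  have hpL := hγL k (by lia)
  -- The quadrilateral `1, z, h * z, h` is cut by the diagonal `f`. Its ends `b` and `e` have length
  -- `d 1 h` and are too far from `p`, so `p` is within `2 * δ` of the translate `τ` of `σ`.
  obtain ⟨w, hw, hpw⟩ := hδ _ _ _ σ e f hσ he hf p (σ.getVert_mem_support k)
  change d p w ≤ δ at hpw
  rcases hw with hw | hw
  · have t1 := hsub _ _ _ e he hw
    have t2 := tri 1 p z
    have t3 := tri 1 p w
    have t4 := tri 1 w z
    have t5 := symm w z
    lia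
  obtain ⟨u, hu, hwu⟩ := hδ _ _ _ f b τ hf hb hτg w hw
  change d w u ≤ δ at hwu
  have hpu := tri p w u
  rcases hu with hu | hu
  · have t1 := hsub _ _ _ b hb hu
    have t2 := tri 1 u z
    have t3 := tri u p z
    have t4 := symm u p
    lia
  · obtain ⟨v, hv, rfl⟩ := hτ u hu
    obtain ⟨i, rfl, hi⟩ := Walk.mem_support_iff_exists_getVert.mp hv
    have hi0 := hγ0 i
    have hiL := hγL i (by lia)
    have a1 := tri 1 p (h * z)
    have a2 := tri p (h * σ.getVert i) (h * z)
    -- A shift of more than `2 * δ` between `i` and `k` would give a shortcut from `1` to `h * z` or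
    -- from `h` to `z`, against `h₁` or `h₂`.
    have a3 := hmul h (σ.getVert i) z
    have b1 : d h z = d 1 (h⁻¹ * z) := by simpa using (hmul h⁻¹ h z).symm
    have b2 := tri h p z
    have b3 := tri h (h * σ.getVert i) p
    have b4 : d h (h * σ.getVert i) = d 1 (σ.getVert i) := by simpa using hmul h 1 _
    have b5 := symm (h * σ.getVert i) p
    have c1 := tri p (h * σ.getVert i) (h * p)
    have c2 := hmul h (σ.getVert i) p
    rcases le_total i k with hik | hik
    · have := hγ i k hik
      lia
    · have := hγ k i hik
      have := symm (σ.getVert i) p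
      lia

end CayleyGraph

/-! ### Centralizers -/

open CayleyGraph

/-- In a hyperbolic group, the centralizer of an element `g` of infinite order is covered by
finitely many cosets of the subgroup generated by `g`. -/
theorem GroupIsHyperbolic.exists_finite_zpow_mul_mem {G : Type*} [Group G]
    (hG : GroupIsHyperbolic G) {g : G} (hg : ¬ IsOfFinOrder g) :
    ∃ B : Set G, B.Finite ∧ ∀ z, Commute g z → ∃ m : ℤ, g ^ m * z ∈ B := by
  obtain ⟨S, hS, δ, hδ⟩ := hG
  set T : Set G := (S : Set G)
  set d := (mulCayley T).dist
  have hball := finite_ball S.finite_toSet hS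
  set N := (hball (4 * δ)).toFinset.card with hN
  -- A uniform bound lets one point `p` serve all `N + 1` powers, one more than the ball of radius
  -- `4 * δ` has elements.
  obtain ⟨M, hM⟩ : ∃ M : ℕ, ∀ n ≤ N, d 1 (g ^ n) ≤ M :=
    ⟨∑ n ∈ Finset.range (N + 1), d 1 (g ^ n), fun n hn =>
      Finset.single_le_sum (f := fun n => d 1 (g ^ n)) (fun _ _ => Nat.zero_le _)
        (Finset.mem_range.mpr (by lia))⟩
  refine ⟨{x | d 1 x ≤ 2 * (M + 2 * δ + 1)}, hball _, fun z hz => ?_⟩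
  obtain ⟨m, hm⟩ : ∃ m : ℤ, ∀ i : ℤ, d 1 (g ^ m * z) ≤ d 1 (g ^ i * z) :=
    ⟨_, fun i => Function.argmin_le (fun i : ℤ => d 1 (g ^ i * z)) i⟩
  refine ⟨m, ?_⟩
  by_contra hlong
  simp only [Set.mem_ofPred_eq, not_le] at hlong
  obtain ⟨σ, hσ⟩ := (connected hS).exists_walk_length_eq_dist 1 (g ^ m * z)
  set p := σ.getVert (M + 2 * δ + 1)
  have hdisp : ∀ n ≤ N, d 1 (p⁻¹ * (g ^ n * p)) ≤ 4 * δ := by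
    intro n hn
    have hn' := hM n hn
    have h0 : d 1 (p⁻¹ * (g ^ n * p)) = d p (g ^ n * p) := by
      simpa using dist_mul hS p⁻¹ p (g ^ n * p)
    rw [h0]
    refine dist_mul_getVert_le hS hδ (h := g ^ n) ?_ σ hσ ?_ ?_ ?_ ?_
    · exact (((Commute.refl g).pow_left n).zpow_right m).mul_right (hz.pow_left n)
    · simpa only [← mul_assoc, ← zpow_natCast, ← zpow_add] using hm (n + m)
    · simpa only [← mul_assoc, ← zpow_natCast, ← zpow_neg, ← zpow_add] using hm (-n + m)
    · change d _ _ + _ < _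
      lia
    · change _ + d _ _ + _ < d _ _
      lia
  obtain ⟨i, hi, j, hj, hij, heq⟩ := Finset.exists_ne_map_eq_of_card_lt_of_maps_to
    (s := Finset.range (N + 1)) (t := (hball (4 * δ)).toFinset)
    (f := fun n => p⁻¹ * (g ^ n * p)) (by simp [hN])
    (fun n hn => by
      simpa using hdisp n (by simpa [Nat.lt_succ_iff] using hn))
  exact hij (injective_pow_iff_not_isOfFinOrder.mpr hg (by simpa using heq))

/-- A torsion-free group whose center has finite index is commutative. -/
theorem GroupIsTorsionFree.commute_of_finiteIndex_center {G : Type*} [Group G]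
    (htf : GroupIsTorsionFree G) [(Subgroup.center G).FiniteIndex] (x y : G) : Commute x y := by
  -- The transfer into the center is raising to the power of the index, so its kernel is torsion.
  have hinj : Function.Injective (MonoidHom.transferCenterPow G) := by
    refine (injective_iff_map_eq_one _).mpr fun a ha => ?_
    by_contra hne
    refine htf a hne (isOfFinOrder_iff_pow_eq_one.mpr
      ⟨(Subgroup.center G).index, Nat.pos_of_ne_zero Subgroup.FiniteIndex.index_ne_zero, ?_⟩)
    simpa using congrArg Subtype.val ha
  refine hinj ?_
  rw [map_mul, map_mul]
  exact Subtype.ext (Subgroup.mem_center_iff.mp (MonoidHom.transferCenterPow G y).2 _)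

/-- In a torsion-free hyperbolic group, commuting is transitive on nontrivial elements. -/
theorem GroupIsHyperbolic.commute_of_commute {G : Type*} [Group G] (hG : GroupIsHyperbolic G)
    (htf : GroupIsTorsionFree G) {g x y : G} (hg : g ≠ 1) (hx : Commute g x) (hy : Commute g y) :
    Commute x y := by
  obtain ⟨B, hB, hcov⟩ := hG.exists_finite_zpow_mul_mem (htf g hg)
  let C := Subgroup.centralizer {g}
  have hmem : ∀ {z : G}, z ∈ C ↔ Commute g z := by
    intro z
    simp only [C, Subgroup.mem_centralizer_singleton_iff]
    exact ⟨fun h => h.symm, fun h => h.symm⟩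
  have hCtf : GroupIsTorsionFree C := fun a ha hfin =>
    htf a (by simpa using ha) (Submonoid.isOfFinOrder_coe.mpr hfin)
  have hcenter : ∀ m : ℤ, (⟨g, hmem.mpr (Commute.refl g)⟩ : C) ^ m ∈ Subgroup.center C :=
    fun m => Subgroup.zpow_mem _ (Subgroup.mem_center_iff.mpr fun z =>
      Subtype.ext (hmem.mp z.2).symm.eq) m
  have : Finite (Subtype.val ⁻¹' B : Set C) := (hB.preimage Subtype.val_injective.injOn).to_subtype
  have : Finite (C ⧸ Subgroup.center C) := by
    refine Finite.of_surjective
      (fun b : (Subtype.val ⁻¹' B : Set C) => (QuotientGroup.mk b.1 : C ⧸ Subgroup.center C)) ?_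
    intro q
    induction q using QuotientGroup.induction_on with
    | H z =>
      obtain ⟨m, hm⟩ := hcov z (hmem.mp z.2)
      refine ⟨⟨(⟨g, hmem.mpr (Commute.refl g)⟩ : C) ^ m * z, by simpa using hm⟩, ?_⟩
      change (QuotientGroup.mk (_ * z) : C ⧸ Subgroup.center C) = _
      rw [QuotientGroup.mk_mul, (QuotientGroup.eq_one_iff _).mpr (hcenter m), one_mul]
  have : (Subgroup.center C).FiniteIndex := Subgroup.finiteIndex_of_finite_quotient
  exact congrArg Subtype.val
    (hCtf.commute_of_finiteIndex_center ⟨x, hmem.mpr hx⟩ ⟨y, hmem.mpr hy⟩).eq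

/-! ### Limits of inner automorphisms -/

/-- In a group in which commuting is transitive on nontrivial elements, a pointwise eventually
constant sequence of inner automorphisms has an inner limit. -/
theorem exists_conj_eq_of_eventually_conj_eq {G : Type*} [Group G]
    (hct : ∀ {g x y : G}, g ≠ 1 → Commute g x → Commute g y → Commute x y) (c : ℕ → G) :
    ∃ a : G, ∀ (k : ℕ) (h u : G), (∀ n, k ≤ n → (c n)⁻¹ * h * c n = u) → a⁻¹ * h * a = u := by
  have hcomm : ∀ (a b h : G), a⁻¹ * h * a = b⁻¹ * h * b ↔ Commute (a * b⁻¹) h := by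
    intro a b h
    rw [commute_iff_eq]
    constructor
    · intro e
      have e' : h = a * (b⁻¹ * h * b) * a⁻¹ := by rw [← e]; group
      calc a * b⁻¹ * h = a * (b⁻¹ * h * b) * a⁻¹ * (a * b⁻¹) := by group
        _ = h * (a * b⁻¹) := by rw [← e']
    · intro e
      calc a⁻¹ * h * a = a⁻¹ * (h * (a * b⁻¹)) * b := by group
        _ = b⁻¹ * h * b := by rw [← e]; group
  let K : ℕ → Set G := fun k => {h | ∀ n, k ≤ n → (c n)⁻¹ * h * c n = (c k)⁻¹ * h * c k}
  suffices H : ∃ a : G, ∀ k, ∀ h ∈ K k, a⁻¹ * h * a = (c k)⁻¹ * h * c k by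
    obtain ⟨a, ha⟩ := H
    exact ⟨a, fun k h u hu =>
      (ha k h fun n hn => (hu n hn).trans (hu k le_rfl).symm).trans (hu k le_rfl)⟩
  have hmono : ∀ {k m}, k ≤ m → K k ⊆ K m := fun hkm h hh n hn =>
    (hh n (hkm.trans hn)).trans (hh _ hkm).symm
  by_cases h1 : ∀ k, ∀ h ∈ K k, h = 1
  · exact ⟨1, fun k h hh => by simp [h1 k h hh]⟩
  push Not at h1
  obtain ⟨k₀, h₀, hh₀, hne⟩ := h1
  by_cases h2 : ∃ k, ∀ x, (∀ h ∈ K k, Commute x h) → x = 1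
  · obtain ⟨k₁, hk₁⟩ := h2
    refine ⟨c k₁, fun k h hh => ?_⟩
    have : c (max k k₁) = c k₁ := mul_inv_eq_one.mp
      (hk₁ _ fun v hv => (hcomm _ _ _).mp (hv _ (le_max_right _ _)))
    rw [← this]
    exact hh _ (le_max_left _ _)
  · push Not at h2
    -- A nontrivial `x` centralizing a later `K` makes `h` commute with `h₀`. As `c (max k k₀) * (c
    -- k₀)⁻¹` also commutes with `h₀ ≠ 1`, it commutes with `h`.
    refine ⟨c k₀, fun k h hh => ?_⟩
    obtain ⟨x, hx, hx1⟩ := h2 (max k k₀)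
    have hhh : Commute h₀ h := hct hx1 (hx _ (hmono (le_max_right _ _) hh₀))
      (hx _ (hmono (le_max_left _ _) hh))
    have hc : Commute (c (max k k₀) * (c k₀)⁻¹) h₀ := (hcomm _ _ _).mp (hh₀ _ (le_max_right _ _))
    rw [← (hcomm _ _ _).mpr (hct hne hc.symm hhh)]
    exact hh _ (le_max_left _ _)

/-- Only `a.1⁻¹ * a.2` matters, because the diagonal absorbs a common left factor of both
coordinates. -/
theorem mem_conjSubgroup_diagSubgroup {G : Type*} [Group G] (a x : G × G) :
    x ∈ conjSubgroup (diagSubgroup G) a ↔ (a.1⁻¹ * a.2)⁻¹ * x.1 * (a.1⁻¹ * a.2) = x.2 := by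
  obtain ⟨a₁, a₂⟩ := a
  obtain ⟨x₁, x₂⟩ := x
  simp only [conjSubgroup, diagSubgroup, Subgroup.mem_map, MonoidHom.mem_range]
  constructor
  · rintro ⟨_, ⟨t, rfl⟩, h⟩
    simp only [MulEquiv.toMonoidHom_eq_coe, MonoidHom.coe_coe, MulAut.conj_apply, inv_inv,
      MonoidHom.prod_apply, MonoidHom.id_apply, Prod.inv_mk, Prod.mk_mul_mk, Prod.mk.injEq] at h
    obtain ⟨rfl, rfl⟩ := h
    group
  · rintro rfl
    refine ⟨_, ⟨a₁ * x₁ * a₁⁻¹, rfl⟩, ?_⟩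
    simp [mul_assoc]

theorem mainTheorem7 {G : Type*} [Group G] (hG : GroupIsHyperbolic G)
    (htf : GroupIsTorsionFree G) :
    HasSubconjugacyProperty (diagSubgroup G) := by
  intro g
  obtain ⟨a, ha⟩ := exists_conj_eq_of_eventually_conj_eq
    (fun hg hx hy => hG.commute_of_commute htf hg hx hy) (fun n => (g n).1⁻¹ * (g n).2)
  refine ⟨(1, a), fun x hx => ?_⟩
  simp only [Set.mem_iUnion, Set.mem_iInter, SetLike.mem_coe,
    mem_conjSubgroup_diagSubgroup] at hx ⊢
  obtain ⟨k, hk⟩ := hx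
  simpa using ha k x.1 x.2 hk
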